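/- Let $n\ge 1$ and let $\mathbb{C}P_n$ have homogeneous coordinates $[X_1,\dots,X_{n+1}]$. Let $SU(n+1)$ act on $\mathbb{C}P_n$ on the right by $[X]\cdot g=[Xg]$, and for $A\in\mathfrak{su}(n+1)$ let $\sigma_A$ be the fundamental vector field, $\sigma_A([X])=\frac{d}{ds}\big|_{s=0}[X e^{sA}]$. For $1\le k\le n$ put $$H_k=\tfrac{i}{n+1}\,\mathrm{diag}(\underbrace{n+1-k,\dots,n+1-k}_{k},\underbrace{-k,\dots,-k}_{n+1-k}),\qquad c_k=\frac{\sum_{j\le k}|X_j|^2}{\sum_{j}|X_j|^2}.$$ *The Bruhat Poisson structure $\pi_0$.* Let $\mathfrak{sb}(n+1)$ be the traceless upper triangular complex matrices with real diagonal, identified with $\mathfrak{su}(n+1)^*$ by $\langle A,\xi\rangle=\mathrm{Im}\,\mathrm{Tr}(A\xi)$, and let $p_1,p_2$ be the projections of $\mathfrak{sl}(n+1,\mathbb{C})=\mathfrak{su}(n+1)\oplus\mathfrak{sb}(n+1)$ onto its summands. Let $SU(n+1)$ carry the standard Poisson–Lie structure, normalized on right invariant 1-forms by $$\pi(g)\big(r_{g^{-1}}^*\xi,r_{g^{-1}}^*\eta\big)=\tfrac12\big\langle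 p_1\mathrm{Ad}_{g^{-1}}\xi,\;p_2\mathrm{Ad}_{g^{-1}}\eta\big\rangle .$$ Then $\pi_0$ is the unique bivector on $\mathbb{C}P_n$ for which $g\mapsto[(1,0,\dots,0)g]$, $SU(n+1)\to\mathbb{C}P_n$, is a Poisson map. (With this normalization, on $X_{n+1}\ne0$ one has $\pi_0=i\sum_j(1+|y_j|^2)\,\partial_{y_j}\wedge\partial_{\bar y_j}$ in Lu's coordinates $y_j=z_j\,(1+\sum_{j<l\le n}|z_l|^2)^{-1/2}$, $z_j=X_j/X_{n+1}$.) *The pencil.* Let $\omega_\lambda$ be the Fubini–Study (Kirillov–Kostant) form: if $V,W\in\mathbb{C}^{n+1}$ are orthogonal to $X$ and represent tangent vectors at $[X]$ (the velocities at $s=0$ of $[X+sV]$, $[X+sW]$), then $\omega_\lambda(V,W)=2\,\mathrm{Im}\big(\sum_jV_j\overline{W_j}\big)/\sum_j|X_j|^2$ (for $n=1$, $y=X_1/X_2$: $\omega_\lambda=-i\,dy\wedge d\bar y/(1+|y|^2)^2$). Write $\pi^\sharp(\alpha)=\pi(\alpha,\cdot)$ for a bivector $\pi$ and $\omega_\lambda^\flat(v)=\omega_\lambda(v,\cdot)$.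 Let $\pi_\lambda$ be the inverse of $\omega_\lambda$, i.e. $\pi_\lambda^\sharp=(\omega_\lambda^\flat)^{-1}$; for $t\in\mathbb{R}$ let $\pi_t=\pi_0+t\,\pi_\lambda$ and $\{f,g\}_{\pi_t}=\pi_t(df,dg)$; and let $J_\lambda=\pi_0^\sharp\circ\omega_\lambda^\flat$ be the recursion operator. **Proposition.** Let $1\le k\le n$ and $t\in\mathbb{R}$. 1. On each open set $U\subseteq\mathbb{C}P_n$ on which $c_k\ne 1-t$, the function $b_k=\log|c_k-1+t|$ is smooth and is a local Hamiltonian for $\sigma_{H_k}$ with respect to $\pi_t$: $\pi_t^\sharp(db_k)=\sigma_{H_k}$ on $U$, i.e. $\{b_k,f\}_{\pi_t}=\sigma_{H_k}(f)$ on $U$ for every smooth $f:U\to\mathbb{R}$. 2. On all of $\mathbb{C}P_n$, $J_\lambda(\sigma_{H_k})=(c_k-1)\,\sigma_{H_k}$. The vector field $\sigma_{H_k}$ is not identically zero, so it is an eigenvector of the recursion operator, with eigenvalue the function $c_k-1$. -/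

import Mathlib

open scoped ContDiff Matrix LinearAlgebra.Projectivization

noncomputable section

namespace CPn

/-! ### Complex projective space -/

/-- `ℂPⁿ`, with homogeneous coordinates `[X₁ : … : Xₙ₊₁]` (indexed from `0` in the code). -/
abbrev CP (n : ℕ) : Type := ℙ ℂ (Fin (n + 1) → ℂ)

/-- The quotient topology of `ℂⁿ⁺¹ ∖ {0}`. -/
instance (n : ℕ) : TopologicalSpace (CP n) :=
  TopologicalSpace.coinduced (Projectivization.mk' ℂ) inferInstance

/-- The preimage in `ℂⁿ⁺¹ ∖ {0}` of a set of points of `ℂPⁿ`. -/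
def cone {n : ℕ} (U : Set (CP n)) : Set (Fin (n + 1) → ℂ) :=
  {x | ∃ h : x ≠ 0, Projectivization.mk ℂ x h ∈ U}

open Classical in
/-- The function `x ↦ f [x]` on `ℂⁿ⁺¹ ∖ {0}` (with a dummy value at `0`). -/
def homLift {n : ℕ} (f : CP n → ℝ) (x : Fin (n + 1) → ℂ) : ℝ :=
  if h : x ≠ 0 then f (Projectivization.mk ℂ x h) else 0

/-- `f` is smooth on the open set `U ⊆ ℂPⁿ`.  As `x ↦ [x]` is a surjective submersion, this means
that `x ↦ f [x]` is smooth on the preimage of `U`. -/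
def SmoothOn {n : ℕ} (f : CP n → ℝ) (U : Set (CP n)) : Prop :=
  ContDiffOn ℝ ∞ (homLift f) (cone U)

/-- The tangent space of `ℂPⁿ` at a line `ℓ`: the real vector space `Hom_ℂ(ℓ, ℂⁿ⁺¹/ℓ)`.  The
velocity at `s = 0` of a curve `s ↦ [x(s)]` with `[x(0)] = ℓ` is the map
`x(0) ↦ x'(0) mod ℓ`. -/
abbrev Tan {n : ℕ} (p : CP n) : Type := p.submodule →ₗ[ℂ] ((Fin (n + 1) → ℂ) ⧸ p.submodule)

/-- The cotangent space of `ℂPⁿ` at `p`. -/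
abbrev Cotan {n : ℕ} (p : CP n) : Type := Module.Dual ℝ (Tan p)

lemma rep_mem {n : ℕ} (p : CP n) : p.rep ∈ p.submodule := by
  rw [Projectivization.submodule_eq]; exact Submodule.mem_span_singleton_self _

instance finite_tan {n : ℕ} (p : CP n) : Module.Finite ℝ (Tan p) :=
  Module.Finite.trans ℂ (Tan p)

/-- Evaluation of a tangent vector on the chosen representative of `p`. -/
def evalRep {n : ℕ} (p : CP n) : Tan p →ₗ[ℂ] ((Fin (n + 1) → ℂ) ⧸ p.submodule) where
  toFun φ := φ ⟨p.rep, rep_mem p⟩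
  map_add' _ _ := rfl
  map_smul' _ _ := rfl

lemma homLift_smul {n : ℕ} (f : CP n → ℝ) (c : ℂ) (hc : c ≠ 0) (x : Fin (n + 1) → ℂ) :
    homLift f (c • x) = homLift f x := by
  unfold homLift
  by_cases hx : x = 0
  · simp [hx]
  · have h2 : c • x ≠ 0 := smul_ne_zero hc hx
    rw [dif_pos h2, dif_pos hx]
    congr 1
    rw [Projectivization.mk_eq_mk_iff']
    exact ⟨c, rfl⟩

lemma fderiv_homLift_smul_self {n : ℕ} (f : CP n → ℝ) (x : Fin (n + 1) → ℂ) (c : ℂ) :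
    fderiv ℝ (homLift f) x (c • x) = 0 := by
  by_cases hd : DifferentiableAt ℝ (homLift f) x
  · have h1 : HasDerivAt (fun s : ℝ => x + s • (c • x)) (c • x) 0 := by
      simpa using ((hasDerivAt_id (0 : ℝ)).smul_const (c • x)).const_add x
    have h2 : HasDerivAt (fun s : ℝ => homLift f (x + s • (c • x)))
        (fderiv ℝ (homLift f) x (c • x)) 0 := by
      have h3 : HasFDerivAt (homLift f) (fderiv ℝ (homLift f) x) (x + (0 : ℝ) • (c • x)) := by
        simpa using hd.hasFDerivAt
      exact h3.comp_hasDerivAt (0 : ℝ) h1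
    have h4 : (fun s : ℝ => homLift f (x + s • (c • x))) =ᶠ[nhds 0] fun _ => homLift f x := by
      have hc : ContinuousAt (fun s : ℝ => 1 + (s : ℂ) * c) 0 := by fun_prop
      have hne : ∀ᶠ s : ℝ in nhds 0, 1 + (s : ℂ) * c ≠ 0 := hc.eventually_ne (by simp)
      filter_upwards [hne] with s hs
      rw [← homLift_smul f _ hs x]
      congr 1
      rw [add_smul, one_smul, mul_smul]
      rfl
    exact h2.unique ((hasDerivAt_const (0 : ℝ) (homLift f x)).congr_of_eventuallyEq h4)
  · rw [fderiv_zero_of_not_differentiableAt hd]; rfl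

/-- The differential `df_p` of a function `f` on `ℂPⁿ`: for `φ ∈ Hom_ℂ(ℓ, ℂⁿ⁺¹/ℓ)` and `x ∈ ℓ`
nonzero it is the derivative at `x` of `f ∘ [·]` in the direction of any `w` with
`φ x = w mod ℓ` (see `differential_mk`). -/
def differential {n : ℕ} (f : CP n → ℝ) (p : CP n) : Cotan p :=
  ((p.submodule.restrictScalars ℝ).liftQ (fderiv ℝ (homLift f) p.rep).toLinearMap (by
      intro w hw
      rw [Submodule.restrictScalars_mem, Projectivization.submodule_eq,
        Submodule.mem_span_singleton] at hw
      obtain ⟨c, rfl⟩ := hw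
      exact fderiv_homLift_smul_self f p.rep c)) ∘ₗ
    (Submodule.Quotient.restrictScalarsEquiv ℝ p.submodule).symm.toLinearMap ∘ₗ
    (evalRep p).restrictScalars ℝ

lemma differential_rep {n : ℕ} (f : CP n → ℝ) (p : CP n) (φ : Tan p) (w : Fin (n + 1) → ℂ)
    (hw : φ ⟨p.rep, rep_mem p⟩ = p.submodule.mkQ w) :
    differential f p φ = fderiv ℝ (homLift f) p.rep w := by
  have : evalRep p φ = p.submodule.mkQ w := hw
  simp only [differential, LinearMap.comp_apply, LinearMap.restrictScalars_apply, this]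
  rfl

/-- The differential does not depend on the representative. -/
lemma differential_mk {n : ℕ} (f : CP n → ℝ) (x : Fin (n + 1) → ℂ) (hx : x ≠ 0)
    (φ : Tan (Projectivization.mk ℂ x hx)) (w : Fin (n + 1) → ℂ)
    (hw : φ ⟨x, Submodule.mem_span_singleton_self x⟩ = Submodule.mkQ _ w) :
    differential f (Projectivization.mk ℂ x hx) φ = fderiv ℝ (homLift f) x w := by
  obtain ⟨a, ha⟩ := Projectivization.exists_smul_eq_mk_rep ℂ x hx
  have ha' : (a : ℂ) • x = (Projectivization.mk ℂ x hx).rep := ha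
  rw [differential_rep f _ φ ((a : ℂ) • w)]
  · rw [← ha']
    have hinv : homLift f = fun y => homLift f ((a : ℂ)⁻¹ • y) := by
      funext y; rw [homLift_smul f _ (inv_ne_zero a.ne_zero)]
    let e : (Fin (n + 1) → ℂ) ≃L[ℝ] (Fin (n + 1) → ℂ) :=
      (ContinuousLinearEquiv.smulLeft (R₁ := ℂ) (M₁ := Fin (n + 1) → ℂ) a⁻¹).restrictScalars ℝ
    have he : ∀ y, e y = (a : ℂ)⁻¹ • y := fun y => by
      change a⁻¹ • y = _
      rw [Units.smul_def, Units.val_inv_eq_inv_val]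
    have h2 : homLift f = homLift f ∘ e := by
      funext y
      rw [Function.comp_apply, he, homLift_smul f _ (inv_ne_zero a.ne_zero)]
    conv_lhs => rw [h2]
    rw [e.comp_right_fderiv]
    simp [he, smul_smul]
  · have : (⟨(Projectivization.mk ℂ x hx).rep, rep_mem _⟩ : (Projectivization.mk ℂ x hx).submodule)
        = (a : ℂ) • ⟨x, Submodule.mem_span_singleton_self x⟩ := Subtype.ext ha'.symm
    rw [this, map_smul, hw, map_smul]

/-! ### Bivectors -/

/-- A bivector at `p`, seen as the bilinear form `(α, β) ↦ π(α, β)` on covectors. -/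
abbrev Bivec {n : ℕ} (p : CP n) : Type := Cotan p →ₗ[ℝ] Cotan p →ₗ[ℝ] ℝ

/-- The sharp map of `π`: the tangent vector `π^♯ α = π(α, ·)`. -/
def sharp {n : ℕ} {p : CP n} (π : Bivec p) : Cotan p →ₗ[ℝ] Tan p :=
  (Module.evalEquiv ℝ (Tan p)).symm.toLinearMap ∘ₗ π

lemma apply_sharp {n : ℕ} {p : CP n} (π : Bivec p) (α β : Cotan p) : β (sharp π α) = π α β := by
  simp [sharp]

/-- The bracket `{f, g}_π = π(df, dg)`. -/
def bracket {n : ℕ} (π : ∀ p : CP n, Bivec p) (f g : CP n → ℝ) (p : CP n) : ℝ :=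
  π p (differential f p) (differential g p)

/-! ### The right action of matrices on `ℂPⁿ` -/

/-- The fundamental vector field `σ_A` of the right action `[x] ↦ [x exp(s A)]`, at `p`: the
tangent vector `x ↦ x A mod ℓ`. -/
def fundamental {n : ℕ} (p : CP n) : Matrix (Fin (n + 1)) (Fin (n + 1)) ℂ →ₗ[ℂ] Tan p where
  toFun A := p.submodule.mkQ ∘ₗ A.vecMulLinear ∘ₗ p.submodule.subtype
  map_add' A B := by ext x; simp
  map_smul' c A := by ext x; simp

/-! ### The Poisson-Lie group `SU(n+1)` -/

/-- `𝔰𝔲(n+1)`: traceless skew-Hermitian matrices. -/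
def su (n : ℕ) : Submodule ℝ (Matrix (Fin (n + 1)) (Fin (n + 1)) ℂ) where
  carrier := {A | Aᴴ = -A ∧ A.trace = 0}
  add_mem' := by
    rintro A B ⟨h1, h2⟩ ⟨h3, h4⟩
    refine ⟨?_, by simp [h2, h4]⟩
    rw [Matrix.conjTranspose_add, h1, h3]; abel
  zero_mem' := by simp
  smul_mem' := by
    rintro c A ⟨h1, h2⟩
    exact ⟨by rw [Matrix.conjTranspose_smul, h1]; simp, by simp [h2]⟩

/-- `𝔰𝔟(n+1)`: traceless upper triangular matrices with real diagonal. -/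
def sb (n : ℕ) : Submodule ℝ (Matrix (Fin (n + 1)) (Fin (n + 1)) ℂ) where
  carrier := {A | (∀ i j, j < i → A i j = 0) ∧ (∀ i, (A i i).im = 0) ∧ A.trace = 0}
  add_mem' := by
    rintro A B ⟨h1, h2, h3⟩ ⟨h4, h5, h6⟩
    exact ⟨fun i j h => by simp [h1 i j h, h4 i j h], fun i => by simp [h2, h5], by simp [h3, h6]⟩
  zero_mem' := by simp
  smul_mem' := by
    rintro c A ⟨h1, h2, h3⟩
    exact ⟨fun i j h => by simp [h1 i j h], fun i => by simp [h2], by simp [h3]⟩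

/-- The pairing `⟨A, ξ⟩ = Im Tr (A ξ)`. -/
def imTr {n : ℕ} (A ξ : Matrix (Fin (n + 1)) (Fin (n + 1)) ℂ) : ℝ := (A * ξ).trace.im

/-- The projection of `𝔰𝔩(n+1, ℂ) = 𝔰𝔲(n+1) ⊕ 𝔰𝔟(n+1)` onto `𝔰𝔲(n+1)`. -/
def pr₁ {n : ℕ} : Matrix (Fin (n + 1)) (Fin (n + 1)) ℂ →ₗ[ℝ] Matrix (Fin (n + 1)) (Fin (n + 1)) ℂ
    where
  toFun M := Matrix.of fun i j =>
    if j < i then M i j else if i < j then -star (M j i) else ((M i i).im : ℂ) * Complex.I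
  map_add' M N := by
    ext i j
    simp only [Matrix.of_apply, Matrix.add_apply]
    split_ifs
    · rfl
    · simp; ring
    · simp; ring
  map_smul' c M := by
    ext i j
    simp only [Matrix.of_apply, Matrix.smul_apply, RingHom.id_apply]
    split_ifs
    · rfl
    · simp
    · simp; ring

/-- The projection of `𝔰𝔩(n+1, ℂ) = 𝔰𝔲(n+1) ⊕ 𝔰𝔟(n+1)` onto `𝔰𝔟(n+1)`. -/
def pr₂ {n : ℕ} : Matrix (Fin (n + 1)) (Fin (n + 1)) ℂ →ₗ[ℝ] Matrix (Fin (n + 1)) (Fin (n + 1)) ℂ :=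
  LinearMap.id - pr₁

lemma pr₁_mem {n : ℕ} (M : Matrix (Fin (n + 1)) (Fin (n + 1)) ℂ) (hM : M.trace = 0) :
    pr₁ M ∈ su n := by
  refine ⟨?_, ?_⟩
  · ext i j
    simp only [pr₁, LinearMap.coe_mk, AddHom.coe_mk, Matrix.conjTranspose_apply, Matrix.of_apply,
      Matrix.neg_apply]
    rcases lt_trichotomy i j with h | h | h
    · simp [h, h.not_gt]
    · subst h; simp
    · simp [h, h.not_gt]
  · have : (pr₁ M).trace = (M.trace.im : ℂ) * Complex.I := by
      simp [pr₁, Matrix.trace, Finset.sum_mul]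
    rw [this, hM]; simp

lemma pr₂_mem {n : ℕ} (M : Matrix (Fin (n + 1)) (Fin (n + 1)) ℂ) (hM : M.trace = 0) :
    pr₂ M ∈ sb n := by
  refine ⟨?_, ?_, ?_⟩
  · intro i j h
    simp [pr₂, pr₁, h]
  · intro i
    simp [pr₂, pr₁]
  · have := (pr₁_mem M hM).2
    simp [pr₂, hM, this]

/-- The pairing between `𝔰𝔟(n+1)` and `𝔰𝔲(n+1)`, `(ξ, A) ↦ Im Tr (A ξ)`. -/
def pairing (n : ℕ) : sb n →ₗ[ℝ] su n →ₗ[ℝ] ℝ :=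
  LinearMap.mk₂ ℝ (fun ξ A => imTr A.1 ξ.1)
    (by intros; simp [imTr, mul_add]) (by intros; simp [imTr])
    (by intros; simp [imTr, add_mul]) (by intros; simp [imTr])

lemma imTr_eq {n : ℕ} (B ξ : Matrix (Fin (n + 1)) (Fin (n + 1)) ℂ) :
    imTr B ξ = ∑ i, ∑ j, (ξ i j * B j i).im := by
  unfold imTr
  rw [Matrix.trace_mul_comm]
  simp only [Matrix.trace, Matrix.diag_apply, Matrix.mul_apply, Complex.im_sum]

lemma imTr_triangular {n : ℕ} (B ξ : Matrix (Fin (n + 1)) (Fin (n + 1)) ℂ)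
    (hξ : ∀ i j, j < i → ξ i j = 0)
    (hB : ∀ i j, i ≤ j → ξ i j = 0 ∨ B j i = Complex.I * star (ξ i j)) :
    imTr B ξ = ∑ i, ∑ j, ‖ξ i j‖ ^ 2 := by
  rw [imTr_eq]
  refine Finset.sum_congr rfl fun i _ => Finset.sum_congr rfl fun j _ => ?_
  rcases lt_or_ge j i with h | h
  · simp [hξ i j h]
  · rcases hB i j h with h0 | h0
    · simp [h0]
    · rw [h0, ← Complex.normSq_eq_norm_sq, Complex.normSq_apply]
      simp

lemma eq_zero_of_sum_norm {n : ℕ} (ξ : Matrix (Fin (n + 1)) (Fin (n + 1)) ℂ)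
    (h : ∑ i, ∑ j, ‖ξ i j‖ ^ 2 = 0) : ξ = 0 := by
  ext i j
  have h1 := (Finset.sum_eq_zero_iff_of_nonneg
    (fun i _ => Finset.sum_nonneg fun j _ => sq_nonneg ‖ξ i j‖)).1 h i (Finset.mem_univ i)
  have h2 := (Finset.sum_eq_zero_iff_of_nonneg
    (fun j _ => sq_nonneg ‖ξ i j‖)).1 h1 j (Finset.mem_univ j)
  simpa using h2

/-- The element of `𝔰𝔲(n+1)` dual to `ξ ∈ 𝔰𝔟(n+1)`. -/
def skew {n : ℕ} (ξ : Matrix (Fin (n + 1)) (Fin (n + 1)) ℂ) :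
    Matrix (Fin (n + 1)) (Fin (n + 1)) ℂ :=
  Matrix.of fun i j => Complex.I * if i < j then ξ i j else star (ξ j i)

lemma skew_mem {n : ℕ} (ξ : Matrix (Fin (n + 1)) (Fin (n + 1)) ℂ) (hξ : ξ ∈ sb n) :
    skew ξ ∈ su n := by
  obtain ⟨h1, h2, h3⟩ := hξ
  refine ⟨?_, ?_⟩
  · ext i j
    simp only [skew, Matrix.conjTranspose_apply, Matrix.of_apply, Matrix.neg_apply]
    rcases lt_trichotomy i j with h | h | h
    · simp [h, h.not_gt]
    · subst h
      have : (starRingEnd ℂ) (ξ i i) = ξ i i := Complex.conj_eq_iff_im.2 (h2 i)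
      simp [this]
    · simp [h, h.not_gt]
  · have : (skew ξ).trace = Complex.I * star ξ.trace := by
      simp [skew, Matrix.trace, Finset.mul_sum]
    rw [this, h3]; simp

lemma pairing_injective (n : ℕ) : Function.Injective (pairing n) := by
  rw [injective_iff_map_eq_zero]
  rintro ⟨ξ, hξ⟩ h
  have h1 : imTr (skew ξ) ξ = 0 := LinearMap.congr_fun h ⟨skew ξ, skew_mem ξ hξ⟩
  rw [imTr_triangular _ _ hξ.1] at h1
  · exact Subtype.ext (eq_zero_of_sum_norm ξ h1)
  · intro i j hij
    right
    simp [skew, hij.not_gt]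

lemma pairing_flip_injective (n : ℕ) : Function.Injective (pairing n).flip := by
  rw [injective_iff_map_eq_zero]
  rintro ⟨A, hA1, hA2⟩ h
  have hA : ∀ i j, star (A j i) = -A i j := fun i j => congrFun (congrFun hA1 i) j
  let ξ : Matrix (Fin (n + 1)) (Fin (n + 1)) ℂ :=
    Matrix.of fun i j => if j < i then 0 else Complex.I * star (A j i)
  have hξ : ξ ∈ sb n := by
    refine ⟨fun i j hij => by simp [ξ, hij], fun i => ?_, ?_⟩
    · have h0 := congrArg Complex.re (hA i i)
      simp at h0
      simp [ξ]; linarith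
    · have : ξ.trace = Complex.I * star A.trace := by
        simp [ξ, Matrix.trace, Finset.mul_sum]
      rw [this, hA2]; simp
  have h1 : imTr A ξ = 0 := LinearMap.congr_fun h ⟨ξ, hξ⟩
  rw [imTr_triangular _ _ hξ.1] at h1
  · have h2 := eq_zero_of_sum_norm ξ h1
    have h3 : ∀ i j, i ≤ j → A j i = 0 := fun i j hij => by
      have := congrFun (congrFun h2 i) j
      simpa [ξ, hij.not_gt] using this
    refine Subtype.ext ?_
    ext i j
    rcases le_total j i with hij | hij
    · exact h3 j i hij
    · have := hA i j
      rw [h3 i j hij] at this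
      simpa using this.symm
  · intro i j hij
    right
    simp only [ξ, Matrix.of_apply, hij.not_gt, if_false]
    simp [← mul_assoc]

instance pairing_isPerfPair (n : ℕ) : (pairing n).IsPerfPair :=
  LinearMap.IsPerfPair.of_injective (pairing_injective n) (pairing_flip_injective n)

/-- The identification `𝔰𝔲(n+1)* ≃ 𝔰𝔟(n+1)` given by the pairing. -/
def dualEquiv (n : ℕ) : Module.Dual ℝ (su n) ≃ₗ[ℝ] sb n := (pairing n).toPerfPair.symm

lemma imTr_dualEquiv {n : ℕ} (α : Module.Dual ℝ (su n)) (A : su n) :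
    imTr A.1 (dualEquiv n α).1 = α A :=
  LinearMap.congr_fun (LinearMap.apply_symm_toPerfPair_self (pairing n) α) A

/-- The Poisson tensor at `g ∈ SU(n+1)` of the standard Poisson-Lie structure, evaluated on the
right invariant 1-forms with values `ξ`, `η ∈ 𝔰𝔟(n+1) ≃ 𝔰𝔲(n+1)*` at the identity:
`½ ⟨pr₁ (Ad_{g⁻¹} ξ), pr₂ (Ad_{g⁻¹} η)⟩`. -/
def poissonSU {n : ℕ} (g : Matrix.specialUnitaryGroup (Fin (n + 1)) ℂ) :
    sb n →ₗ[ℝ] sb n →ₗ[ℝ] ℝ :=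
  LinearMap.mk₂ ℝ (fun ξ η =>
      (1 / 2) * imTr (pr₁ ((g⁻¹).1 * ξ.1 * g.1)) (pr₂ ((g⁻¹).1 * η.1 * g.1)))
    (by intros; simp [imTr, mul_add, add_mul])
    (by intros; simp [imTr]; ring)
    (by intros; simp [imTr, mul_add, add_mul])
    (by intros; simp [imTr]; ring)

/-! ### The Bruhat Poisson structure -/

lemma row_ne_zero {n : ℕ} (g : Matrix.specialUnitaryGroup (Fin (n + 1)) ℂ) : g.1 0 ≠ 0 := by
  intro h
  have h1 : g.1.det = 1 := (Matrix.mem_specialUnitaryGroup_iff.1 g.2).2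
  rw [Matrix.det_eq_zero_of_row_eq_zero 0 (fun j => congrFun h j)] at h1
  exact zero_ne_one h1

/-- The projection `SU(n+1) → S(U(1) × U(n)) ∖ SU(n+1) = ℂPⁿ`, `g ↦ [(1, 0, …, 0) g]`. -/
def proj {n : ℕ} (g : Matrix.specialUnitaryGroup (Fin (n + 1)) ℂ) : CP n :=
  Projectivization.mk ℂ (g.1 0) (row_ne_zero g)

/-- The pull back along `proj` of a covector `α` at `p = proj g`, as an element of
`𝔰𝔲(n+1)* ≃ 𝔰𝔟(n+1)` via right translation by `g`.  Note that the curve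
`s ↦ [(1, 0, …, 0) exp(s A) g] = [(1, 0, …, 0) g exp(s g⁻¹ A g)]` has velocity `σ_{g⁻¹ A g}`. -/
def pullback {n : ℕ} (g : Matrix.specialUnitaryGroup (Fin (n + 1)) ℂ) (p : CP n) :
    Cotan p →ₗ[ℝ] sb n :=
  (dualEquiv n).toLinearMap ∘ₗ LinearMap.mk₂ ℝ
    (fun (α : Cotan p) (A : su n) => α (fundamental p ((g⁻¹).1 * A.1 * g.1)))
    (by intros; simp)
    (by intros; simp)
    (by intros; simp [mul_add, add_mul])
    (by
      intro c α A
      have h : fundamental p ((g⁻¹).1 * (c • A).1 * g.1)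
          = c • fundamental p ((g⁻¹).1 * A.1 * g.1) := by
        ext x
        simp [fundamental]
      rw [h, map_smul])

theorem proj_surjective (n : ℕ) : Function.Surjective (proj (n := n)) := by
  intro p
  obtain ⟨x, hx, rfl⟩ : ∃ x hx, Projectivization.mk ℂ x hx = p :=
    ⟨p.rep, p.rep_nonzero, p.mk_rep⟩
  obtain ⟨y, hyx⟩ : ∃ y : EuclideanSpace ℂ (Fin (n + 1)), ∀ j, y j = x j :=
    ⟨WithLp.toLp 2 x, fun _ => rfl⟩
  have hy : y ≠ 0 := fun h => hx (by funext j; rw [← hyx, h]; rfl)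
  obtain ⟨u, hu'⟩ : ∃ u : EuclideanSpace ℂ (Fin (n + 1)), u = ((‖y‖ : ℂ)⁻¹) • y := ⟨_, rfl⟩
  have hu : ‖u‖ = 1 := by
    rw [hu', norm_smul, norm_inv, Complex.norm_real, norm_norm]
    exact inv_mul_cancel₀ (norm_ne_zero_iff.2 hy)
  have ho : Orthonormal ℂ (({0} : Set (Fin (n + 1))).domRestrict fun _ => u) := by
    refine ⟨fun _ => hu, ?_⟩
    rintro ⟨i, hi⟩ ⟨j, hj⟩ hij
    exact absurd (Subtype.ext (hi.trans hj.symm)) hij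
  obtain ⟨b, hb⟩ := ho.exists_orthonormalBasis_extension_of_card_eq (by simp)
  have hb0 : b 0 = u := hb 0 rfl
  let G : Matrix (Fin (n + 1)) (Fin (n + 1)) ℂ := Matrix.of fun i j => b i j
  have hG : G * Gᴴ = 1 := by
    ext i j
    have h := orthonormal_iff_ite.1 b.orthonormal j i
    rw [PiLp.inner_apply] at h
    rw [Matrix.mul_apply, Matrix.one_apply]
    simp only [RCLike.inner_apply] at h
    simpa [G, eq_comm] using h
  have hd : G.det * star G.det = 1 := by
    rw [← Matrix.det_conjTranspose, ← Matrix.det_mul, hG, Matrix.det_one]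
  let D : Matrix (Fin (n + 1)) (Fin (n + 1)) ℂ :=
    Matrix.diagonal (Function.update 1 0 (star G.det))
  have hDdet : D.det = star G.det := by
    simp only [D, Matrix.det_diagonal]
    rw [Finset.prod_update_of_mem (Finset.mem_univ _)]
    simp
  have hD : D * Dᴴ = 1 := by
    simp only [D, Matrix.diagonal_conjTranspose, Matrix.diagonal_mul_diagonal]
    rw [← Matrix.diagonal_one]
    congr 1
    funext i
    by_cases hi : i = 0
    · subst hi
      simpa [mul_comm] using hd
    · simp [hi]
  have hmem : D * G ∈ Matrix.specialUnitaryGroup (Fin (n + 1)) ℂ := by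
    rw [Matrix.mem_specialUnitaryGroup_iff, Matrix.mem_unitaryGroup_iff]
    refine ⟨?_, ?_⟩
    · rw [Matrix.star_eq_conjTranspose, Matrix.conjTranspose_mul, mul_assoc, ← mul_assoc G, hG,
        one_mul, hD]
    · rw [Matrix.det_mul, hDdet, mul_comm, hd]
  refine ⟨⟨D * G, hmem⟩, ?_⟩
  rw [proj, Projectivization.mk_eq_mk_iff']
  refine ⟨star G.det * (‖y‖ : ℂ)⁻¹, ?_⟩
  ext j
  simp [D, G, hb0, hu', hyx, mul_assoc]

/-- The Bruhat Poisson structure `π₀` on `ℂPⁿ`, i.e. the one for which `proj` is a Poisson map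
(see `bruhat_proj`). -/
def bruhat {n : ℕ} (p : CP n) : Bivec p :=
  (poissonSU (proj_surjective n p).choose).compl₁₂
    (pullback (proj_surjective n p).choose p) (pullback (proj_surjective n p).choose p)

lemma imTr_pullback {n : ℕ} (g : Matrix.specialUnitaryGroup (Fin (n + 1)) ℂ) (p : CP n)
    (α : Cotan p) (A : su n) :
    imTr A.1 (pullback g p α).1 = α (fundamental p ((g⁻¹).1 * A.1 * g.1)) :=
  imTr_dualEquiv _ A

lemma inv_val {n : ℕ} (g : Matrix.specialUnitaryGroup (Fin (n + 1)) ℂ) : (g⁻¹).1 = (g.1)ᴴ := rfl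

lemma mul_inv_val {n : ℕ} (g : Matrix.specialUnitaryGroup (Fin (n + 1)) ℂ) :
    g.1 * (g⁻¹).1 = 1 := congrArg Subtype.val (mul_inv_cancel g)

lemma inv_mul_val {n : ℕ} (g : Matrix.specialUnitaryGroup (Fin (n + 1)) ℂ) :
    (g⁻¹).1 * g.1 = 1 := congrArg Subtype.val (inv_mul_cancel g)

/-- Infinitesimal stabilisers act trivially. -/
lemma fundamental_eq_zero {n : ℕ} (g : Matrix.specialUnitaryGroup (Fin (n + 1)) ℂ)
    (A : Matrix (Fin (n + 1)) (Fin (n + 1)) ℂ) (hA : ∀ j, 0 < j → A 0 j = 0) :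
    fundamental (proj g) ((g⁻¹).1 * A * g.1) = 0 := by
  ext ⟨x, hx⟩
  obtain ⟨c, rfl⟩ := Submodule.mem_span_singleton.1 hx
  have h0 : g.1 0 = Pi.single 0 1 ᵥ* g.1 := by ext j; simp
  have h1 : g.1 0 ᵥ* ((g⁻¹).1 * A * g.1) = A 0 0 • g.1 0 := by
    have h2 : (Pi.single 0 1 : Fin (n + 1) → ℂ) ᵥ* A = A 0 0 • Pi.single 0 1 := by
      ext j
      rcases (Fin.zero_le j).eq_or_lt' with h | h
      · subst h; simp
      · simp [hA j h, h.ne']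
    conv_lhs => rw [h0]
    rw [Matrix.vecMul_vecMul, ← mul_assoc, ← mul_assoc, mul_inv_val, one_mul,
      ← Matrix.vecMul_vecMul, h2, Matrix.smul_vecMul, ← h0]
  change Submodule.mkQ _ ((c • g.1 0) ᵥ* ((g⁻¹).1 * A * g.1)) = 0
  rw [Matrix.smul_vecMul, h1, Submodule.mkQ_apply, Submodule.Quotient.mk_eq_zero]
  exact Submodule.smul_mem _ _ (Submodule.smul_mem _ _ (Submodule.mem_span_singleton_self _))

/-- Pull backs of covectors lie in the annihilator of the stabiliser. -/
lemma pullback_apply_eq_zero {n : ℕ} (g : Matrix.specialUnitaryGroup (Fin (n + 1)) ℂ)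
    (α : Cotan (proj g)) (i j : Fin (n + 1)) (hij : ¬(i = 0 ∧ 0 < j)) :
    (pullback g _ α).1 i j = 0 := by
  obtain ⟨ξ, hξ⟩ : ∃ ξ, pullback g _ α = ξ := ⟨_, rfl⟩
  rw [hξ]
  let η : Matrix (Fin (n + 1)) (Fin (n + 1)) ℂ :=
    Matrix.of fun i j => if i = 0 ∧ 0 < j then 0 else ξ.1 i j
  have hη : η ∈ sb n := by
    obtain ⟨h1, h2, h3⟩ := ξ.2
    refine ⟨fun i j h => by simp [η, h1 i j h], fun i => ?_, ?_⟩
    · by_cases hi : i = 0 ∧ 0 < i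
      · exact absurd hi.2 (hi.1 ▸ lt_irrefl _)
      · simp only [η, Matrix.of_apply, hi, if_false]; exact h2 i
    · rw [← h3]
      refine Finset.sum_congr rfl fun i _ => ?_
      have hi : ¬(i = 0 ∧ 0 < i) := by rintro ⟨rfl, h⟩; exact lt_irrefl _ h
      simp [η, hi]
  have h1 : imTr (skew η) ξ.1 = 0 := by
    rw [← hξ, imTr_pullback g _ α ⟨skew η, skew_mem η hη⟩, fundamental_eq_zero, map_zero]
    intro j hj
    simp [skew, η, hj]
  have h2 : imTr (skew η) ξ.1 = imTr (skew η) η := by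
    rw [imTr_eq, imTr_eq]
    refine Finset.sum_congr rfl fun i _ => Finset.sum_congr rfl fun j _ => ?_
    by_cases h : i = 0 ∧ 0 < j
    · have : skew η j i = 0 := by simp [skew, η, h]
      rw [this, mul_zero, mul_zero]
    · simp [η, h]
  rw [h2, imTr_triangular _ _ hη.1] at h1
  · have := congrFun (congrFun (eq_zero_of_sum_norm η h1) i) j
    simpa [η, hij] using this
  · intro i j hij
    right
    simp [skew, hij.not_gt]

/-- `Ad_{g⁻¹}` of the pull back does not depend on the representative `g`. -/
lemma pullback_indep {n : ℕ} (g g' : Matrix.specialUnitaryGroup (Fin (n + 1)) ℂ) (p : CP n)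
    (hg : proj g = p) (hg' : proj g' = p) (α : Cotan p) :
    (g'⁻¹).1 * (pullback g' p α).1 * g'.1 = (g⁻¹).1 * (pullback g p α).1 * g.1 := by
  subst hg
  obtain ⟨c, hc⟩ := (Projectivization.mk_eq_mk_iff ℂ _ _ (row_ne_zero g') (row_ne_zero g)).1 hg'
  have hc1 : ∀ l, g'.1 0 l = (c : ℂ) * g.1 0 l := fun l => (congrFun hc l).symm
  let h := g' * g⁻¹
  have hh : ∀ i j, h.1 i j = ∑ l, g'.1 i l * star (g.1 j l) := fun i j => by
    change (g'.1 * (g⁻¹).1) i j = _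
    rw [Matrix.mul_apply]; rfl
  have ho : ∀ (k : Matrix.specialUnitaryGroup (Fin (n + 1)) ℂ) i j,
      ∑ l, k.1 i l * star (k.1 j l) = if i = j then 1 else 0 := fun k i j => by
    rw [← Matrix.one_apply, ← mul_inv_val k, Matrix.mul_apply]; rfl
  have hr : ∀ j, 0 < j → h.1 0 j = 0 := fun j hj => by
    rw [hh]
    simp only [hc1, mul_assoc]
    rw [← Finset.mul_sum, ho, if_neg hj.ne, mul_zero]
  have hl : ∀ i, 0 < i → h.1 i 0 = 0 := fun i hi => by
    rw [hh]
    have : ∀ l, g.1 0 l = (c : ℂ)⁻¹ * g'.1 0 l := fun l => by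
      rw [hc1, ← mul_assoc, inv_mul_cancel₀ c.ne_zero, one_mul]
    simp only [this, star_mul, ← mul_assoc]
    rw [← Finset.sum_mul, ho, if_neg hi.ne', zero_mul]
  obtain ⟨ξ, hξ⟩ : ∃ ξ, pullback g _ α = ξ := ⟨_, rfl⟩
  have hξ0 : ∀ i j, ¬(i = 0 ∧ 0 < j) → ξ.1 i j = 0 := by
    rw [← hξ]; exact pullback_apply_eq_zero g α
  have hent : ∀ i j, ¬(i = 0 ∧ 0 < j) → (h.1 * ξ.1 * (h⁻¹).1) i j = 0 := by
    intro i j hij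
    rw [Matrix.mul_apply]
    refine Finset.sum_eq_zero fun l _ => ?_
    rw [Matrix.mul_apply, Finset.sum_mul]
    refine Finset.sum_eq_zero fun m _ => ?_
    by_cases hm : m = 0 ∧ 0 < l
    · obtain ⟨rfl, hl0⟩ := hm
      rcases (Fin.zero_le i).eq_or_lt' with hi | hi
      · have hj : j = 0 := by
          rcases (Fin.zero_le j).eq_or_lt' with hj | hj
          · exact hj
          · exact absurd ⟨hi, hj⟩ hij
        subst hj
        have : (h⁻¹).1 l 0 = star (h.1 0 l) := rfl
        rw [this, hr l hl0, star_zero, mul_zero]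
      · rw [hl i hi, zero_mul, zero_mul]
    · rw [hξ0 m l hm, mul_zero, zero_mul]
  have hsb : h.1 * ξ.1 * (h⁻¹).1 ∈ sb n := by
    refine ⟨fun i j hij => hent i j ?_, fun i => ?_, ?_⟩
    · rintro ⟨rfl, h2⟩; exact absurd (hij.trans h2) (lt_irrefl _)
    · rw [hent i i (by rintro ⟨rfl, h2⟩; exact lt_irrefl _ h2)]; rfl
    · exact Finset.sum_eq_zero fun i _ => hent i i (by rintro ⟨rfl, h2⟩; exact lt_irrefl _ h2)
  have hgh : h.1 * g.1 = g'.1 := by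
    change g'.1 * (g⁻¹).1 * g.1 = g'.1
    rw [mul_assoc, inv_mul_val, mul_one]
  have hgh' : (g⁻¹).1 * (h⁻¹).1 = (g'⁻¹).1 := by
    rw [inv_val g, inv_val h, inv_val g', ← hgh, Matrix.conjTranspose_mul]
  have key : pullback g' (proj g) α = ⟨h.1 * ξ.1 * (h⁻¹).1, hsb⟩ := by
    apply pairing_injective n
    refine LinearMap.ext fun A => ?_
    change imTr A.1 (pullback g' (proj g) α).1 = imTr A.1 (h.1 * ξ.1 * (h⁻¹).1)
    have hA : (h⁻¹).1 * A.1 * h.1 ∈ su n := by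
      refine ⟨?_, ?_⟩
      · rw [inv_val, Matrix.conjTranspose_mul, Matrix.conjTranspose_mul,
          Matrix.conjTranspose_conjTranspose, A.2.1]
        simp [mul_assoc]
      · rw [mul_assoc, Matrix.trace_mul_comm, mul_assoc, mul_inv_val, mul_one, A.2.2]
    have h1 : imTr A.1 (h.1 * ξ.1 * (h⁻¹).1) = imTr ((h⁻¹).1 * A.1 * h.1) ξ.1 := by
      unfold imTr
      rw [← mul_assoc, Matrix.trace_mul_comm]
      simp only [mul_assoc]
    rw [h1, ← hξ, imTr_pullback, imTr_pullback g _ α ⟨_, hA⟩, ← hgh, ← hgh']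
    simp only [mul_assoc]
  rw [key, hξ]
  simp only
  rw [← hgh', ← hgh]
  have e : (g⁻¹).1 * (h⁻¹).1 * (h.1 * ξ.1 * (h⁻¹).1) * (h.1 * g.1)
      = (g⁻¹).1 * ((h⁻¹).1 * h.1) * ξ.1 * ((h⁻¹).1 * h.1) * g.1 := by
    simp only [mul_assoc]
  rw [e, inv_mul_val, mul_one, mul_one]

/-- `proj` is a Poisson map. -/
theorem bruhat_proj {n : ℕ} (g : Matrix.specialUnitaryGroup (Fin (n + 1)) ℂ)
    (α β : Cotan (proj g)) :
    bruhat (proj g) α β = poissonSU g (pullback g _ α) (pullback g _ β) := by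
  have h := (proj_surjective n (proj g)).choose_spec
  simp only [bruhat, LinearMap.compl₁₂_apply, poissonSU, LinearMap.mk₂_apply]
  rw [pullback_indep g _ (proj g) rfl h α, pullback_indep g _ (proj g) rfl h β]

/-! ### The Fubini-Study form, the pencil and the recursion operator -/

lemma dot_star_eq_zero {ι : Type} [Fintype ι] (w : ι → ℂ) (h : w ⬝ᵥ star w = 0) : w = 0 := by
  have h1 : ∑ j, Complex.normSq (w j) = 0 := by
    have h2 := congrArg Complex.re h
    simpa [dotProduct, Complex.normSq_apply] using h2
  funext j
  exact Complex.normSq_eq_zero.1 ((Finset.sum_eq_zero_iff_of_nonneg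
    (fun j _ => Complex.normSq_nonneg (w j))).1 h1 j (Finset.mem_univ j))

/-- The linear section `ℂⁿ⁺¹/ℓ → ℂⁿ⁺¹` with image `ℓ^⊥`. -/
def horizontal {n : ℕ} (p : CP n) :
    ((Fin (n + 1) → ℂ) ⧸ p.submodule) →ₗ[ℂ] (Fin (n + 1) → ℂ) :=
  p.submodule.liftQ
    { toFun := fun w => w - ((w ⬝ᵥ star p.rep) / (p.rep ⬝ᵥ star p.rep)) • p.rep
      map_add' := fun v w => by rw [add_dotProduct, add_div, add_smul]; abel
      map_smul' := fun c w => by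
        simp only [smul_dotProduct, smul_eq_mul, RingHom.id_apply, smul_sub, mul_div_assoc,
          mul_smul] }
    (by
      intro w hw
      rw [Projectivization.submodule_eq, Submodule.mem_span_singleton] at hw
      obtain ⟨c, rfl⟩ := hw
      have h : p.rep ⬝ᵥ star p.rep ≠ 0 := by
        exact fun h0 => p.rep_nonzero (dot_star_eq_zero _ h0)
      simp [div_self h])

/-- The Fubini-Study (Kirillov-Kostant) form `ω_λ`: if `x` spans `ℓ` and `v`, `w ∈ ℓ^⊥` represent
`φ x`, `ψ x`, then `ω_λ(φ, ψ) = 2 Im (∑ⱼ vⱼ w̄ⱼ) / ∑ⱼ |xⱼ|²`. -/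
def fubiniStudy {n : ℕ} (p : CP n) : Tan p →ₗ[ℝ] Tan p →ₗ[ℝ] ℝ :=
  LinearMap.mk₂ ℝ (fun φ ψ =>
      2 * (horizontal p (evalRep p φ) ⬝ᵥ star (horizontal p (evalRep p ψ))).im
        / ∑ j, ‖p.rep j‖ ^ 2)
    (by intros; simp [add_dotProduct]; ring)
    (by intros; simp [smul_dotProduct]; ring)
    (by intros; simp [dotProduct_add]; ring)
    (by intros; simp [dotProduct_smul]; ring)

lemma horizontal_injective {n : ℕ} (p : CP n) : Function.Injective (horizontal p) := by
  rw [injective_iff_map_eq_zero]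
  intro q hq
  obtain ⟨w, rfl⟩ := Submodule.Quotient.mk_surjective _ q
  have h : w - ((w ⬝ᵥ star p.rep) / (p.rep ⬝ᵥ star p.rep)) • p.rep = 0 := hq
  rw [Submodule.Quotient.mk_eq_zero, sub_eq_zero.1 h]
  exact Submodule.smul_mem _ _ (rep_mem p)

lemma evalRep_injective {n : ℕ} (p : CP n) : Function.Injective (evalRep p) := by
  rw [injective_iff_map_eq_zero]
  intro φ hφ
  ext ⟨x, hx⟩
  have hx' := hx
  rw [Projectivization.submodule_eq, Submodule.mem_span_singleton] at hx'
  obtain ⟨c, rfl⟩ := hx'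
  have : (⟨c • p.rep, hx⟩ : p.submodule) = c • ⟨p.rep, rep_mem p⟩ := rfl
  rw [this, map_smul]
  change c • evalRep p φ = 0
  rw [hφ, smul_zero]

lemma fubiniStudy_injective {n : ℕ} (p : CP n) : Function.Injective (fubiniStudy p) := by
  rw [injective_iff_map_eq_zero]
  intro φ hφ
  have h := LinearMap.congr_fun hφ (Complex.I • φ)
  have hx : ∑ j, ‖p.rep j‖ ^ 2 ≠ 0 := by
    intro h0
    apply p.rep_nonzero
    funext j
    have := (Finset.sum_eq_zero_iff_of_nonneg (fun j _ => sq_nonneg ‖p.rep j‖)).1 h0 j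
      (Finset.mem_univ j)
    simpa using this
  simp only [fubiniStudy, LinearMap.mk₂_apply, map_smul, star_smul, dotProduct_smul,
    LinearMap.zero_apply, div_eq_zero_iff, hx, or_false] at h
  have h2 : (horizontal p (evalRep p φ) ⬝ᵥ star (horizontal p (evalRep p φ))) = 0 := by
    apply Complex.ext
    · simpa using h
    · simp [dotProduct, mul_comm]
  have h3 := dot_star_eq_zero _ h2
  apply evalRep_injective p
  apply horizontal_injective p
  rw [h3, map_zero, map_zero]

/-- `λ = 1/(n+1) diag(n, -1, …, -1)`. -/
def weight (n : ℕ) : Matrix (Fin (n + 1)) (Fin (n + 1)) ℂ :=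
  Matrix.diagonal fun j => if j = 0 then (n / (n + 1) : ℂ) else -(1 / (n + 1))

/-- `fubiniStudy` is the Kirillov-Kostant form: its pull back along `proj` is
`i Tr ((dg g⁻¹)² λ)`. -/
theorem fubiniStudy_proj {n : ℕ} (g : Matrix.specialUnitaryGroup (Fin (n + 1)) ℂ) (A B : su n) :
    (fubiniStudy (proj g) (fundamental _ ((g⁻¹).1 * A.1 * g.1))
      (fundamental _ ((g⁻¹).1 * B.1 * g.1)) : ℂ)
      = Complex.I * ((A.1 * B.1 - B.1 * A.1) * weight n).trace := by
  obtain ⟨a, ha⟩ := Projectivization.exists_smul_eq_mk_rep ℂ (g.1 0) (row_ne_zero g)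
  have hrep : (proj g).rep = (a : ℂ) • g.1 0 := ha.symm
  have hu : ∀ v w : Fin (n + 1) → ℂ, (v ᵥ* g.1) ⬝ᵥ star (w ᵥ* g.1) = v ⬝ᵥ star w := by
    intro v w
    rw [Matrix.star_vecMul, ← Matrix.dotProduct_mulVec, Matrix.mulVec_mulVec, ← inv_val,
      mul_inv_val, Matrix.one_mulVec]
  have h0 : g.1 0 = Pi.single 0 1 ᵥ* g.1 := by ext j; simp
  have hg0 : g.1 0 ⬝ᵥ star (g.1 0) = 1 := by
    conv_lhs => rw [h0]
    rw [hu]; simp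
  have hh : ∀ C : su n, horizontal (proj g) (evalRep (proj g)
      (fundamental (proj g) ((g⁻¹).1 * C.1 * g.1)))
      = (a : ℂ) • ((C.1 0 - C.1 0 0 • Pi.single 0 1) ᵥ* g.1) := by
    intro C
    have e1 : (proj g).rep ᵥ* ((g⁻¹).1 * C.1 * g.1) = (a : ℂ) • (C.1 0 ᵥ* g.1) := by
      rw [hrep, Matrix.smul_vecMul]
      congr 1
      conv_lhs => rw [h0]
      rw [Matrix.vecMul_vecMul, ← mul_assoc, ← mul_assoc, mul_inv_val, one_mul,
        ← Matrix.vecMul_vecMul]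
      congr 1
      ext j; simp
    have e2 : (C.1 0 ᵥ* g.1) ⬝ᵥ star (g.1 0) = C.1 0 0 := by
      conv_lhs => rw [h0]
      rw [hu]; simp
    change (proj g).rep ᵥ* ((g⁻¹).1 * C.1 * g.1) - (((proj g).rep ᵥ* ((g⁻¹).1 * C.1 * g.1)) ⬝ᵥ
      star (proj g).rep / ((proj g).rep ⬝ᵥ star (proj g).rep)) • (proj g).rep = _
    rw [e1, hrep, star_smul, smul_dotProduct, smul_dotProduct, dotProduct_smul, dotProduct_smul,
      e2, hg0, Matrix.sub_vecMul, Matrix.smul_vecMul, ← h0, smul_sub]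
    congr 1
    have hne : (a : ℂ) ≠ 0 := a.ne_zero
    have hne' : star (a : ℂ) ≠ 0 := star_ne_zero.2 hne
    simp only [smul_eq_mul, mul_one]
    rw [← mul_assoc, mul_div_cancel_left₀ _ (mul_ne_zero hne hne'), smul_comm]
  have hn : ((∑ j, ‖(proj g).rep j‖ ^ 2 : ℝ) : ℂ) = a * star (a : ℂ) := by
    have : ((∑ j, ‖(proj g).rep j‖ ^ 2 : ℝ) : ℂ) = (proj g).rep ⬝ᵥ star (proj g).rep := by
      simp [dotProduct, Complex.mul_conj, Complex.normSq_eq_norm_sq]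
    rw [this, hrep, star_smul, smul_dotProduct, dotProduct_smul, hg0]
    simp
  have hs : ∀ C : su n, ∀ i j, star (C.1 i j) = -C.1 j i := fun C i j =>
    congrFun (congrFun C.2.1 j) i
  have hdiag : ∀ C : su n, (C.1 0 0).re = 0 := fun C => by
    have h1 := congrArg Complex.re (hs C 0 0)
    simp at h1
    linarith
  have hw : (A.1 0 - A.1 0 0 • Pi.single 0 1) ⬝ᵥ star (B.1 0 - B.1 0 0 • Pi.single 0 1)
      = -(A.1 * B.1) 0 0 + A.1 0 0 * B.1 0 0 := by
    have h1 : A.1 0 ⬝ᵥ star (B.1 0) = -(A.1 * B.1) 0 0 := by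
      rw [Matrix.mul_apply, ← Finset.sum_neg_distrib]
      refine Finset.sum_congr rfl fun j _ => ?_
      rw [Pi.star_apply, hs, mul_neg]
    have h2 : (starRingEnd ℂ) (B.1 0 0) = -B.1 0 0 := hs B 0 0
    rw [star_sub, star_smul, dotProduct_sub, sub_dotProduct, sub_dotProduct, h1]
    simp [h2]
  have hc : (B.1 * A.1) 0 0 = star ((A.1 * B.1) 0 0) := by
    rw [Matrix.mul_apply, Matrix.mul_apply, star_sum]
    refine Finset.sum_congr rfl fun j _ => ?_
    rw [star_mul, hs, hs, neg_mul_neg]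
  have htr : ((A.1 * B.1 - B.1 * A.1) * weight n).trace
      = (A.1 * B.1) 0 0 - (B.1 * A.1) 0 0 := by
    have hne : (n + 1 : ℂ) ≠ 0 := by exact_mod_cast n.succ_ne_zero
    have hwt : weight n = Matrix.diagonal (Pi.single 0 1) - (1 / (n + 1 : ℂ)) • 1 := by
      rw [weight, ← Matrix.diagonal_one, ← Matrix.diagonal_smul, Matrix.diagonal_sub]
      congr 1
      funext j
      by_cases hj : j = 0
      · subst hj
        simp
        field_simp
        ring
      · simp [hj]
    rw [hwt, mul_sub, Matrix.trace_sub, Matrix.mul_smul, mul_one, Matrix.trace_smul,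
      Matrix.trace_sub, Matrix.trace_mul_comm A.1 B.1, sub_self, smul_zero, sub_zero]
    simp only [Matrix.trace, Matrix.diag_apply, Matrix.mul_diagonal]
    rw [Finset.sum_eq_single 0 (by intro j _ hj; simp [hj]) (by simp)]
    simp
  have hN : (a : ℂ) * star (a : ℂ) = (Complex.normSq a : ℂ) := Complex.mul_conj _
  have hN0 : Complex.normSq (a : ℂ) ≠ 0 := (Complex.normSq_pos.2 a.ne_zero).ne'
  have hn' : ∑ j, ‖(proj g).rep j‖ ^ 2 = Complex.normSq (a : ℂ) := by
    rw [hN] at hn; exact_mod_cast hn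
  have hval : fubiniStudy (proj g) (fundamental _ ((g⁻¹).1 * A.1 * g.1))
      (fundamental _ ((g⁻¹).1 * B.1 * g.1)) = -2 * ((A.1 * B.1) 0 0).im := by
    simp only [fubiniStudy, LinearMap.mk₂_apply]
    rw [hh A, hh B, hn', star_smul, smul_dotProduct, dotProduct_smul, hu, hw, smul_eq_mul,
      smul_eq_mul, ← mul_assoc, hN, Complex.im_ofReal_mul, Complex.add_im, Complex.mul_im,
      hdiag A, hdiag B, Complex.neg_im]
    field_simp
    ring
  rw [hval, htr, hc]
  apply Complex.ext <;> simp
  ring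

/-- The isomorphism `ω_λ^♭ : v ↦ ω_λ(v, ·)` from the tangent to the cotangent space. -/
def flat {n : ℕ} (p : CP n) : Tan p ≃ₗ[ℝ] Cotan p :=
  LinearEquiv.ofBijective (fubiniStudy p) ⟨fubiniStudy_injective p,
    (LinearMap.injective_iff_surjective_of_finrank_eq_finrank
      Subspace.dual_finrank_eq.symm).1 (fubiniStudy_injective p)⟩

/-- The inverse `π_λ` of `ω_λ`: the bivector whose sharp map is the inverse of `ω_λ^♭`. -/
def piLambda {n : ℕ} (p : CP n) : Bivec p :=
  Module.Dual.eval ℝ (Tan p) ∘ₗ (flat p).symm.toLinearMap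

/-- The Poisson pencil `π_t = π₀ + t π_λ`. -/
def pencil {n : ℕ} (t : ℝ) (p : CP n) : Bivec p := bruhat p + t • piLambda p

/-- The recursion operator `J_λ = π₀^♯ ∘ ω_λ^♭`. -/
def recursion {n : ℕ} (p : CP n) : Tan p →ₗ[ℝ] Tan p := sharp (bruhat p) ∘ₗ fubiniStudy p

/-! ### The Cartan action -/

/-- `H_k = i/(n+1) diag(n+1-k, …, n+1-k, -k, …, -k)`, with `k` entries `n+1-k`. -/
def cartanH (n k : ℕ) : Matrix (Fin (n + 1)) (Fin (n + 1)) ℂ :=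
  (Complex.I / (n + 1)) •
    Matrix.diagonal fun j => if j.val < k then (n + 1 - k : ℂ) else -(k : ℂ)

/-- `c_k = (|X₁|² + ⋯ + |X_k|²) / (|X₁|² + ⋯ + |Xₙ₊₁|²)`. -/
def momentum {n : ℕ} (k : ℕ) (p : CP n) : ℝ :=
  (∑ j with j.val < k, ‖p.rep j‖ ^ 2) / ∑ j, ‖p.rep j‖ ^ 2

/-- `b_k = log |c_k - 1 + t|`. -/
def actionVar {n : ℕ} (t : ℝ) (k : ℕ) (p : CP n) : ℝ := Real.log |momentum k p - 1 + t|

end CPn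

end

/-!
The `c_k` are momentum functions of the Cartan action: `ω_λ^♭ σ_{H_k} = dc_k`
(`differential_actionVar`).  Everything therefore reduces to the identity
`π₀(ω_λ^♭ σ_{H_k}, ·) = (c_k - 1) σ_{H_k}` (`bruhat_fubiniStudy`).  It is the statement on `J_λ`, and
with `π_λ^♯ dc_k = σ_{H_k}` it gives `π_t^♯ dc_k = (c_k - 1 + t) σ_{H_k}`, hence
`π_t^♯ d log |c_k - 1 + t| = σ_{H_k}`.

For the identity, let `p = [x]` with `x` the first row of `g ∈ SU(n+1)`, let `E` be the Hermitian
projection onto `p`, and `P` the projection onto the first `k` coordinates, so `H_k = iP + const` and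
`E P E = c_k E`.  The pull back of a covector `β` to the group, conjugated by `g⁻¹`, is a traceless
matrix `N` with `E N = N` and `β(σ_H) = Im Tr (H N)`; for `β = ω_λ^♭ σ_{H_k}` it is
`-2i E (P - c_k)`.  Because `P` is a diagonal projection onto *first* coordinates, the
`𝔰𝔲`-component of that matrix has a closed form (`pr₁_lineProj`),
`-2i (P E + E P - P E P - c_k E)`, whose product with `N = E N` is `-2i (1 - c_k) P N`.  Since `𝔰𝔲` is
isotropic for `Im Tr`, half the imaginary part of the trace of this product is the value of `π₀`.
-/

namespace CPn

/-! ### The Cartan elements -/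

/-- The diagonal projection of `ℂⁿ⁺¹` onto its first `k` coordinates. -/
noncomputable def firstProj (n k : ℕ) : Matrix (Fin (n + 1)) (Fin (n + 1)) ℂ :=
  Matrix.diagonal fun j => if j.val < k then 1 else 0

lemma cartanH_eq (n k : ℕ) :
    cartanH n k = Complex.I • firstProj n k - (Complex.I * (k / (n + 1))) • 1 := by
  have hne : (n + 1 : ℂ) ≠ 0 := by exact_mod_cast n.succ_ne_zero
  rw [cartanH, firstProj, ← Matrix.diagonal_one, ← Matrix.diagonal_smul, ← Matrix.diagonal_smul,
    ← Matrix.diagonal_smul, Matrix.diagonal_sub]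
  congr 1
  funext j
  simp only [Pi.smul_apply, smul_eq_mul]
  split_ifs <;> field_simp; ring

lemma cartanH_mem_su (n k : ℕ) (hkn : k ≤ n) : cartanH n k ∈ su n := by
  refine ⟨?_, ?_⟩
  · rw [cartanH_eq, firstProj]
    ext i j
    by_cases h : i = j
    · subst h
      simp only [Matrix.conjTranspose_apply, Matrix.sub_apply, Matrix.smul_apply,
        Matrix.diagonal_apply_eq, Matrix.one_apply_eq, Matrix.neg_apply]
      split_ifs <;> simp; ring
    · simp [h, Ne.symm h]
  · have hne : (n + 1 : ℂ) ≠ 0 := by exact_mod_cast n.succ_ne_zero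
    have hcard : (Finset.univ.filter fun j : Fin (n + 1) => j.val < k).card = k := by
      rw [Fin.card_filter_val_lt]; omega
    have htr : (firstProj n k).trace = k := by
      rw [firstProj, Matrix.trace_diagonal, Finset.sum_boole, hcard]
    rw [cartanH_eq, Matrix.trace_sub, Matrix.trace_smul, Matrix.trace_smul, htr, Matrix.trace_one]
    simp
    field_simp
    ring

/-! ### The momentum functions and their differentials -/

lemma momentum_mk {n : ℕ} (k : ℕ) (x : Fin (n + 1) → ℂ) (hx : x ≠ 0) :
    momentum k (Projectivization.mk ℂ x hx)
      = (∑ j with j.val < k, ‖x j‖ ^ 2) / ∑ j, ‖x j‖ ^ 2 := by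
  obtain ⟨a, ha⟩ := Projectivization.exists_smul_eq_mk_rep ℂ x hx
  have ha' : ∀ j, ‖(Projectivization.mk ℂ x hx).rep j‖ ^ 2 = ‖(a : ℂ)‖ ^ 2 * ‖x j‖ ^ 2 := by
    intro j
    rw [← ha, ← mul_pow, ← norm_mul]
    rfl
  have hne : ‖(a : ℂ)‖ ^ 2 ≠ 0 := pow_ne_zero 2 (norm_ne_zero_iff.2 a.ne_zero)
  simp only [momentum, ha', ← Finset.mul_sum]
  exact mul_div_mul_left _ _ hne

lemma sum_norm_sq_ne_zero {n : ℕ} {x : Fin (n + 1) → ℂ} (hx : x ≠ 0) :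
    ∑ j, ‖x j‖ ^ 2 ≠ 0 := by
  intro h0
  apply hx
  funext j
  have := (Finset.sum_eq_zero_iff_of_nonneg (fun j _ => sq_nonneg ‖x j‖)).1 h0 j
    (Finset.mem_univ j)
  simpa using this

lemma contDiff_sum_norm_sq {n : ℕ} (s : Finset (Fin (n + 1))) :
    ContDiff ℝ ∞ fun x : Fin (n + 1) → ℂ => ∑ j ∈ s, ‖x j‖ ^ 2 :=
  ContDiff.sum fun j _ => (contDiff_apply ℝ ℂ j).norm_sq ℝ

lemma fderiv_sum_norm_sq {n : ℕ} (s : Finset (Fin (n + 1))) (x w : Fin (n + 1) → ℂ) :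
    fderiv ℝ (fun x : Fin (n + 1) → ℂ => ∑ j ∈ s, ‖x j‖ ^ 2) x w
      = 2 * ∑ j ∈ s, (x j * star (w j)).re := by
  have h : HasFDerivAt (fun x : Fin (n + 1) → ℂ => ∑ j ∈ s, ‖x j‖ ^ 2) _ x :=
    HasFDerivAt.fun_sum fun j _ => (hasFDerivAt_apply (𝕜 := ℝ) j x).norm_sq
  rw [h.fderiv, Finset.mul_sum]
  simp [Complex.inner]
  refine Finset.sum_congr rfl fun j _ => by ring

lemma homLift_actionVar {n : ℕ} (t : ℝ) (k : ℕ) (x : Fin (n + 1) → ℂ) (hx : x ≠ 0) :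
    homLift (actionVar t k) x
      = Real.log ((∑ j with j.val < k, ‖x j‖ ^ 2) / (∑ j, ‖x j‖ ^ 2) - 1 + t) := by
  rw [homLift, dif_pos hx, actionVar, Real.log_abs, momentum_mk]

lemma smoothOn_actionVar {n : ℕ} (t : ℝ) (k : ℕ) (U : Set (CP n))
    (hU : ∀ p ∈ U, momentum k p ≠ 1 - t) : SmoothOn (actionVar t k) U := by
  have h : ∀ x ∈ cone U, homLift (actionVar t k) x
      = Real.log ((∑ j with j.val < k, ‖x j‖ ^ 2) / (∑ j, ‖x j‖ ^ 2) - 1 + t) :=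
    fun x hx => homLift_actionVar t k x hx.choose
  refine ContDiffOn.congr (fun x hx => ?_) h
  obtain ⟨hx0, hxU⟩ := hx
  have hne := hU _ hxU
  rw [momentum_mk] at hne
  refine ContDiffAt.contDiffWithinAt (ContDiffAt.log ?_ ?_)
  · exact (((contDiff_sum_norm_sq _).contDiffAt.div (contDiff_sum_norm_sq _).contDiffAt
      (sum_norm_sq_ne_zero hx0)).sub contDiffAt_const).add contDiffAt_const
  · intro h0
    exact hne (by linarith)

lemma vecMul_cartanH_dotProduct {n : ℕ} (k : ℕ) (x w : Fin (n + 1) → ℂ) :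
    (x ᵥ* cartanH n k) ⬝ᵥ star w
      = Complex.I * ∑ j with j.val < k, x j * star (w j)
        - Complex.I * (k / (n + 1)) * (x ⬝ᵥ star w) := by
  have h : (x ᵥ* firstProj n k) ⬝ᵥ star w = ∑ j with j.val < k, x j * star (w j) := by
    rw [Finset.sum_filter]
    refine Finset.sum_congr rfl fun j _ => ?_
    rw [firstProj, Matrix.vecMul_diagonal]
    split_ifs <;> simp
  rw [cartanH_eq, Matrix.vecMul_sub, Matrix.vecMul_smul, Matrix.vecMul_smul, Matrix.vecMul_one,
    sub_dotProduct, smul_dotProduct, smul_dotProduct, h, smul_eq_mul, smul_eq_mul]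

lemma hasFDerivAt_log_quotient {E : Type*} [NormedAddCommGroup E] [NormedSpace ℝ E]
    {a b : E → ℝ} {a' b' : E →L[ℝ] ℝ} {x : E} {t : ℝ} (ha : HasFDerivAt a a' x)
    (hb : HasFDerivAt b b' x) (hb0 : b x ≠ 0) (h : a x / b x - 1 + t ≠ 0) :
    HasFDerivAt (fun y => Real.log (a y / b y - 1 + t))
      ((a x / b x - 1 + t)⁻¹ • ((b x)⁻¹ • a' - (a x / b x ^ 2) • b')) x := by
  have hinv : HasFDerivAt (fun y => (b y)⁻¹) _ x := (hasDerivAt_inv hb0).comp_hasFDerivAt x hb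
  have hdiv : HasFDerivAt (fun y => a y / b y) ((b x)⁻¹ • a' - (a x / b x ^ 2) • b') x := by
    simp only [div_eq_mul_inv]
    refine (ha.mul hinv).congr_fderiv ?_
    ext v
    simp
    ring
  exact ((hdiv.sub_const 1).add_const t).log h

/-- `c_k` is a Hamiltonian for `σ_{H_k}` with respect to `ω_λ`, so the differential of
`log |c_k - 1 + t|` is `(c_k - 1 + t)⁻¹ ω_λ^♭ σ_{H_k}`. -/
theorem differential_actionVar {n : ℕ} (t : ℝ) (k : ℕ) (p : CP n) (hp : momentum k p ≠ 1 - t) :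
    differential (actionVar t k) p
      = (momentum k p - 1 + t)⁻¹ • fubiniStudy p (fundamental p (cartanH n k)) := by
  refine LinearMap.ext fun φ => ?_
  obtain ⟨w, hw⟩ := Submodule.Quotient.mk_surjective _ (φ ⟨p.rep, rep_mem p⟩)
  rw [differential_rep _ _ φ w hw.symm]
  have hx := p.rep_nonzero
  have hQ := sum_norm_sq_ne_zero hx
  have hev : homLift (actionVar t k) =ᶠ[nhds p.rep] fun x =>
      Real.log ((∑ j with j.val < k, ‖x j‖ ^ 2) / (∑ j, ‖x j‖ ^ 2) - 1 + t) := by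
    filter_upwards [isOpen_ne.mem_nhds hx] with x hx
    exact homLift_actionVar t k x hx
  have hd : ∀ s : Finset (Fin (n + 1)),
      HasFDerivAt (fun x : Fin (n + 1) → ℂ => ∑ j ∈ s, ‖x j‖ ^ 2)
        (fderiv ℝ (fun x : Fin (n + 1) → ℂ => ∑ j ∈ s, ‖x j‖ ^ 2) p.rep) p.rep := fun s =>
    ((contDiff_sum_norm_sq s).differentiable (by simp) p.rep).hasFDerivAt
  have hne : (∑ j with j.val < k, ‖p.rep j‖ ^ 2) / (∑ j, ‖p.rep j‖ ^ 2) - 1 + t ≠ 0 := by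
    intro h0
    exact hp (by rw [momentum]; linarith)
  have hF := hasFDerivAt_log_quotient (hd {j | j.val < k}) (hd Finset.univ) hQ hne
  rw [hev.fderiv_eq, hF.fderiv]
  have hφ : evalRep p φ = p.submodule.mkQ w := hw.symm
  have hW : horizontal p (evalRep p φ)
      = w - ((w ⬝ᵥ star p.rep) / (p.rep ⬝ᵥ star p.rep)) • p.rep := by
    rw [hφ]; rfl
  have hV : horizontal p (evalRep p (fundamental p (cartanH n k)))
      = p.rep ᵥ* cartanH n k - (((p.rep ᵥ* cartanH n k) ⬝ᵥ star p.rep) /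
        (p.rep ⬝ᵥ star p.rep)) • p.rep := rfl
  have hQc : p.rep ⬝ᵥ star p.rep = ((∑ j, ‖p.rep j‖ ^ 2 : ℝ) : ℂ) := by
    simp [dotProduct, Complex.mul_conj, Complex.normSq_eq_norm_sq]
  have hPc : ∑ j with j.val < k, p.rep j * star (p.rep j)
      = ((∑ j with j.val < k, ‖p.rep j‖ ^ 2 : ℝ) : ℂ) := by
    simp [Complex.mul_conj, Complex.normSq_eq_norm_sq]
  have hsw : star (w ⬝ᵥ star p.rep) = p.rep ⬝ᵥ star w := by
    simp [dotProduct, mul_comm]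
  have hQc0 : ((∑ j, ‖p.rep j‖ ^ 2 : ℝ) : ℂ) ≠ 0 := by exact_mod_cast hQ
  have hVW : horizontal p (evalRep p (fundamental p (cartanH n k))) ⬝ᵥ
      star (horizontal p (evalRep p φ))
      = Complex.I * (∑ j with j.val < k, p.rep j * star (w j)
        - ((∑ j with j.val < k, ‖p.rep j‖ ^ 2 : ℝ) : ℂ) / ((∑ j, ‖p.rep j‖ ^ 2 : ℝ) : ℂ) *
          (p.rep ⬝ᵥ star w)) := by
    rw [hV, hW, star_sub, star_smul, star_div₀, hsw]
    simp only [sub_dotProduct, dotProduct_sub, smul_dotProduct, dotProduct_smul, smul_eq_mul,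
      vecMul_cartanH_dotProduct, hQc, hPc]
    rw [Complex.star_def, Complex.conj_ofReal]
    field_simp
    ring
  have hre : (p.rep ⬝ᵥ star w).re = ∑ j, (p.rep j * star (w j)).re := by
    rw [dotProduct, Complex.re_sum]; rfl
  simp only [fubiniStudy, LinearMap.mk₂_apply, LinearMap.smul_apply, smul_eq_mul]
  rw [hVW, ← Complex.ofReal_div, Complex.I_mul_im, Complex.sub_re, Complex.re_ofReal_mul, hre,
    Complex.re_sum]
  simp only [smul_apply, sub_apply, fderiv_sum_norm_sq,
    smul_eq_mul, momentum]
  congr 1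
  field_simp

/-! ### The Bruhat structure on the momentum covector -/

lemma imTr_skewHermitian {n : ℕ} (A B : Matrix (Fin (n + 1)) (Fin (n + 1)) ℂ)
    (hA : Aᴴ = -A) (hB : Bᴴ = -B) : imTr A B = 0 := by
  have h : star (A * B).trace = (A * B).trace := by
    rw [← Matrix.trace_conjTranspose, Matrix.conjTranspose_mul, hA, hB, neg_mul_neg,
      Matrix.trace_mul_comm]
  exact Complex.conj_eq_iff_im.1 h

lemma conj_mem_su {n : ℕ} (g : Matrix.specialUnitaryGroup (Fin (n + 1)) ℂ)
    (H : Matrix (Fin (n + 1)) (Fin (n + 1)) ℂ) (hH : H ∈ su n) :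
    g.1 * H * (g⁻¹).1 ∈ su n := by
  refine ⟨?_, ?_⟩
  · rw [inv_val, Matrix.conjTranspose_mul, Matrix.conjTranspose_mul,
      Matrix.conjTranspose_conjTranspose, hH.1]
    simp [mul_assoc]
  · rw [mul_assoc, Matrix.trace_mul_comm, mul_assoc, inv_mul_val, mul_one, hH.2]

lemma inv_mul_conj_mul {n : ℕ} (g : Matrix.specialUnitaryGroup (Fin (n + 1)) ℂ)
    (H : Matrix (Fin (n + 1)) (Fin (n + 1)) ℂ) :
    (g⁻¹).1 * (g.1 * H * (g⁻¹).1) * g.1 = H := by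
  rw [mul_assoc, mul_assoc, mul_assoc, inv_mul_val, mul_one, ← mul_assoc, inv_mul_val, one_mul]

/-- A covector evaluated on a fundamental field is the pairing with `Ad_{g⁻¹}` of its pull back. -/
lemma apply_fundamental {n : ℕ} (g : Matrix.specialUnitaryGroup (Fin (n + 1)) ℂ)
    (β : Cotan (proj g)) (H : Matrix (Fin (n + 1)) (Fin (n + 1)) ℂ) (hH : H ∈ su n) :
    β (fundamental (proj g) H) = imTr H ((g⁻¹).1 * (pullback g _ β).1 * g.1) := by
  have h := imTr_pullback g _ β ⟨_, conj_mem_su g H hH⟩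
  simp only [inv_mul_conj_mul] at h
  rw [← h, imTr, imTr, mul_assoc, mul_assoc, Matrix.trace_mul_comm]
  simp only [mul_assoc]

/-- The pull back of `ω_λ(σ_{g⁻¹ A g}, ·)` is `-2` times the first row of `A` without its diagonal
entry. -/
lemma pullback_fubiniStudy {n : ℕ} (g : Matrix.specialUnitaryGroup (Fin (n + 1)) ℂ) (A : su n) :
    (pullback g _ (fubiniStudy (proj g) (fundamental _ ((g⁻¹).1 * A.1 * g.1)))).1
      = Matrix.of fun i j => if i = 0 ∧ 0 < j then -2 * A.1 0 j else 0 := by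
  set ζ : Matrix (Fin (n + 1)) (Fin (n + 1)) ℂ :=
    Matrix.of fun i j => if i = 0 ∧ 0 < j then -2 * A.1 0 j else 0 with hζ
  have hd : ∀ i, ζ i i = 0 := fun i => by
    have : ¬(i = 0 ∧ 0 < i) := by rintro ⟨rfl, h⟩; exact lt_irrefl _ h
    simp only [hζ, Matrix.of_apply, this, if_false]
  have hmem : ζ ∈ sb n := by
    refine ⟨fun i j h => ?_, fun i => by rw [hd]; rfl, Finset.sum_eq_zero fun i _ => hd i⟩
    have : ¬(i = 0 ∧ 0 < j) := by rintro ⟨rfl, h2⟩; exact absurd (h.trans h2) (lt_irrefl _)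
    simp only [hζ, Matrix.of_apply, this, if_false]
  have key : pullback g _ (fubiniStudy (proj g) (fundamental _ ((g⁻¹).1 * A.1 * g.1)))
      = ⟨ζ, hmem⟩ := by
    apply pairing_injective n
    refine LinearMap.ext fun B => ?_
    change imTr B.1 (pullback g _ _).1 = imTr B.1 ζ
    rw [imTr_pullback]
    have hs : ∀ C : su n, ∀ i j, C.1 j i = -star (C.1 i j) := fun C i j => by
      rw [show star (C.1 i j) = -C.1 j i from congrFun (congrFun C.2.1 j) i, neg_neg]
    have hne : (n + 1 : ℂ) ≠ 0 := by exact_mod_cast n.succ_ne_zero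
    have hwt : weight n = Matrix.diagonal (Pi.single 0 1) - (1 / (n + 1 : ℂ)) • 1 := by
      rw [weight, ← Matrix.diagonal_one, ← Matrix.diagonal_smul, Matrix.diagonal_sub]
      congr 1
      funext j
      by_cases hj : j = 0
      · subst hj
        simp
        field_simp
        ring
      · simp [hj]
    have htr : ((A.1 * B.1 - B.1 * A.1) * weight n).trace
        = (A.1 * B.1) 0 0 - (B.1 * A.1) 0 0 := by
      rw [hwt, mul_sub, Matrix.trace_sub, Matrix.mul_smul, mul_one, Matrix.trace_smul,
        Matrix.trace_sub, Matrix.trace_mul_comm A.1 B.1, sub_self, smul_zero, sub_zero]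
      simp only [Matrix.trace, Matrix.diag_apply, Matrix.mul_diagonal]
      rw [Finset.sum_eq_single 0 (by intro j _ hj; simp [hj]) (by simp)]
      simp
    have hc : (B.1 * A.1) 0 0 = star ((A.1 * B.1) 0 0) := by
      rw [Matrix.mul_apply, Matrix.mul_apply, star_sum]
      refine Finset.sum_congr rfl fun j _ => ?_
      rw [star_mul, hs B j 0, hs A 0 j, neg_mul_neg]
    have h1 := congrArg Complex.re (fubiniStudy_proj g A B)
    rw [htr, hc, Complex.ofReal_re] at h1
    have h2 : imTr B.1 ζ = ∑ j, (ζ 0 j * B.1 j 0).im := by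
      rw [imTr_eq, Finset.sum_eq_single 0 _ (by simp)]
      intro i _ hi
      refine Finset.sum_eq_zero fun j _ => ?_
      simp [hζ, hi]
    have h3 : ∀ j, (ζ 0 j * B.1 j 0).im = -2 * (A.1 0 j * B.1 j 0).im := by
      intro j
      rcases (Fin.zero_le j).eq_or_lt' with h | h
      · subst h
        have ha := congrArg Complex.re (hs A 0 0)
        have hb := congrArg Complex.re (hs B 0 0)
        simp at ha hb
        have ha' : (A.1 0 0).re = 0 := by linarith
        have hb' : (B.1 0 0).re = 0 := by linarith
        rw [hd]
        simp [ha', hb']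
      · simp [hζ, h]
        ring
    rw [h1, h2, Finset.sum_congr rfl fun j _ => h3 j, ← Finset.mul_sum, ← Complex.im_sum,
      ← Matrix.mul_apply]
    simp
    ring
  rw [key]

lemma sum_row_norm {n : ℕ} (g : Matrix.specialUnitaryGroup (Fin (n + 1)) ℂ) :
    ∑ j, ‖g.1 0 j‖ ^ 2 = 1 := by
  have h : (g.1 * (g⁻¹).1) 0 0 = 1 := by rw [mul_inv_val, Matrix.one_apply_eq]
  rw [inv_val, Matrix.mul_apply] at h
  have h2 : ((∑ j, ‖g.1 0 j‖ ^ 2 : ℝ) : ℂ) = 1 := by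
    rw [← h]
    push_cast
    exact Finset.sum_congr rfl fun j _ => by
      rw [Matrix.conjTranspose_apply, Complex.star_def, Complex.mul_conj,
        Complex.normSq_eq_norm_sq]
      push_cast
      rfl
  exact_mod_cast h2

/-- The Hermitian projection of `ℂⁿ⁺¹` onto the line `proj g`. -/
noncomputable def lineProj {n : ℕ} (g : Matrix.specialUnitaryGroup (Fin (n + 1)) ℂ) :
    Matrix (Fin (n + 1)) (Fin (n + 1)) ℂ :=
  Matrix.vecMulVec (star (g.1 0)) (g.1 0)

lemma lineProj_eq {n : ℕ} (g : Matrix.specialUnitaryGroup (Fin (n + 1)) ℂ) :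
    lineProj g = (g⁻¹).1 * Matrix.diagonal (Pi.single 0 1) * g.1 := by
  ext i j
  rw [lineProj, Matrix.vecMulVec_apply, Matrix.mul_apply, Finset.sum_eq_single 0]
  · simp [inv_val]
  · intro l _ hl
    simp [hl]
  · simp

lemma lineProj_mul_self {n : ℕ} (g : Matrix.specialUnitaryGroup (Fin (n + 1)) ℂ) :
    lineProj g * lineProj g = lineProj g := by
  have e : (g⁻¹).1 * Matrix.diagonal (Pi.single 0 1) * g.1 *
      ((g⁻¹).1 * Matrix.diagonal (Pi.single 0 1) * g.1) =
      (g⁻¹).1 * (Matrix.diagonal (Pi.single 0 1) * (g.1 * (g⁻¹).1) *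
        Matrix.diagonal (Pi.single 0 1)) * g.1 := by
    simp only [mul_assoc]
  rw [lineProj_eq, e, mul_inv_val, mul_one, Matrix.diagonal_mul_diagonal]
  congr 3
  funext j
  by_cases hj : j = 0 <;> simp [hj]

lemma lineProj_mul_firstProj_mul_lineProj {n : ℕ} (k : ℕ)
    (g : Matrix.specialUnitaryGroup (Fin (n + 1)) ℂ) :
    lineProj g * firstProj n k * lineProj g = (momentum k (proj g) : ℂ) • lineProj g := by
  have h : (momentum k (proj g) : ℂ)
      = ∑ j, g.1 0 j * (if j.val < k then 1 else 0) * star (g.1 0 j) := by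
    rw [proj, momentum_mk, sum_row_norm, div_one, Finset.sum_filter]
    push_cast
    refine Finset.sum_congr rfl fun j _ => ?_
    rw [Complex.star_def]
    split_ifs
    · rw [mul_one, Complex.mul_conj, Complex.normSq_eq_norm_sq,
        Complex.ofReal_pow]
    · simp
  ext i j
  rw [Matrix.smul_apply, h, Matrix.mul_apply, Finset.sum_smul]
  refine Finset.sum_congr rfl fun l _ => ?_
  rw [firstProj, Matrix.mul_diagonal]
  simp only [lineProj, Matrix.vecMulVec_apply, Pi.star_apply, smul_eq_mul]
  ring

/-- `Ad_{g⁻¹}` of a pull back has image in the line `proj g`. -/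
lemma lineProj_mul_conj_pullback {n : ℕ} (g : Matrix.specialUnitaryGroup (Fin (n + 1)) ℂ)
    (β : Cotan (proj g)) :
    lineProj g * ((g⁻¹).1 * (pullback g _ β).1 * g.1) = (g⁻¹).1 * (pullback g _ β).1 * g.1 := by
  have h : Matrix.diagonal (Pi.single 0 1) * (pullback g _ β).1 = (pullback g _ β).1 := by
    ext i j
    rw [Matrix.diagonal_mul]
    by_cases hi : i = 0
    · simp [hi]
    · rw [pullback_apply_eq_zero g β i j (fun h => hi h.1), mul_zero]
  have e : (g⁻¹).1 * Matrix.diagonal (Pi.single 0 1) * g.1 *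
      ((g⁻¹).1 * (pullback g _ β).1 * g.1) =
      (g⁻¹).1 * (Matrix.diagonal (Pi.single 0 1) * ((g.1 * (g⁻¹).1) * (pullback g _ β).1)) *
        g.1 := by
    simp only [mul_assoc]
  rw [lineProj_eq, e, mul_inv_val, one_mul, h]

lemma conj_pullback_fubiniStudy {n k : ℕ} (hkn : k ≤ n)
    (g : Matrix.specialUnitaryGroup (Fin (n + 1)) ℂ) :
    (g⁻¹).1 * (pullback g _ (fubiniStudy (proj g) (fundamental _ (cartanH n k)))).1 * g.1
      = (-2 * Complex.I) •
        (lineProj g * firstProj n k - (momentum k (proj g) : ℂ) • lineProj g) := by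
  have h := pullback_fubiniStudy g ⟨_, conj_mem_su g _ (cartanH_mem_su n k hkn)⟩
  simp only [inv_mul_conj_mul] at h
  have h0 : (Matrix.of fun i j => if i = 0 ∧ 0 < j then
        -2 * (g.1 * cartanH n k * (g⁻¹).1) 0 j else 0)
      = (-2 : ℂ) • (Matrix.diagonal (Pi.single 0 1) * (g.1 * cartanH n k * (g⁻¹).1) *
        (1 - Matrix.diagonal (Pi.single 0 1))) := by
    rw [← Matrix.diagonal_one, Matrix.diagonal_sub]
    ext i j
    rw [Matrix.smul_apply, Matrix.mul_diagonal, Matrix.diagonal_mul]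
    by_cases hi : i = 0
    · rcases (Fin.zero_le j).eq_or_lt' with hj | hj
      · simp [hi, hj]
      · simp [hi, hj, hj.ne']
    · simp [hi]
  have e : (g⁻¹).1 * ((-2 : ℂ) • (Matrix.diagonal (Pi.single 0 1) *
        (g.1 * cartanH n k * (g⁻¹).1) * (1 - Matrix.diagonal (Pi.single 0 1)))) * g.1
      = (-2 : ℂ) • (((g⁻¹).1 * Matrix.diagonal (Pi.single 0 1) * g.1) * cartanH n k *
        ((g⁻¹).1 * g.1 - (g⁻¹).1 * Matrix.diagonal (Pi.single 0 1) * g.1)) := by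
    simp only [Matrix.mul_smul, Matrix.smul_mul, mul_assoc, mul_sub, sub_mul, mul_one]
  rw [h, h0, e, ← lineProj_eq, inv_mul_val, cartanH_eq]
  simp only [mul_sub, sub_mul, Matrix.mul_smul, Matrix.smul_mul, mul_one, lineProj_mul_self,
    lineProj_mul_firstProj_mul_lineProj]
  module

/-- The `𝔰𝔲`-component of `Ad_{g⁻¹}` of the pull back of `ω_λ(σ_{H_k}, ·)`.  The projection `pr₁`
keeps the lower triangle, so the coordinate projection acts through the smaller index
`min i j`, and `min i j < k` iff `i < k` or `j < k`. -/
lemma pr₁_lineProj {n : ℕ} (k : ℕ) (c : ℝ) (g : Matrix.specialUnitaryGroup (Fin (n + 1)) ℂ) :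
    pr₁ ((-2 * Complex.I) • (lineProj g * firstProj n k - (c : ℂ) • lineProj g))
      = (-2 * Complex.I) • (firstProj n k * lineProj g + lineProj g * firstProj n k
        - firstProj n k * lineProj g * firstProj n k - (c : ℂ) • lineProj g) := by
  ext i j
  simp only [pr₁, LinearMap.coe_mk, AddHom.coe_mk, Matrix.of_apply, firstProj, Matrix.smul_apply,
    Matrix.sub_apply, Matrix.add_apply, Matrix.mul_diagonal, Matrix.diagonal_mul, lineProj,
    Matrix.vecMulVec_apply, Pi.star_apply, smul_eq_mul]
  rcases lt_trichotomy i j with h | h | h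
  · rw [if_neg h.not_gt, if_pos h]
    have hv : i.val < j.val := h
    by_cases hi : i.val < k
    · by_cases hj : j.val < k <;> simp [hi, hj] <;> ring
    · have hj : ¬ j.val < k := by omega
      simp [hi, hj]
      left; ring
  · subst h
    rw [if_neg (lt_irrefl _), if_neg (lt_irrefl _)]
    by_cases hi : i.val < k
    · apply Complex.ext <;> simp [hi]; ring
    · apply Complex.ext
      · simp [hi]
        right; ring
      · simp [hi]
  · rw [if_pos h]
    have hv : j.val < i.val := h
    by_cases hj : j.val < k
    · by_cases hi : i.val < k <;> simp [hi, hj]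
    · have hi : ¬ i.val < k := by omega
      simp [hi, hj]

/-- `π₀(ω_λ^♭ σ_{H_k}, ·) = (c_k - 1) σ_{H_k}`. -/
theorem bruhat_fubiniStudy {n k : ℕ} (hkn : k ≤ n) (p : CP n) (β : Cotan p) :
    bruhat p (fubiniStudy p (fundamental p (cartanH n k))) β
      = (momentum k p - 1) * β (fundamental p (cartanH n k)) := by
  obtain ⟨g, rfl⟩ := proj_surjective n p
  rw [bruhat_proj, apply_fundamental g β _ (cartanH_mem_su n k hkn)]
  simp only [poissonSU, LinearMap.mk₂_apply]
  have hM := conj_pullback_fubiniStudy hkn g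
  obtain ⟨M, hMdef⟩ : ∃ M, (g⁻¹).1 * (pullback g _ (fubiniStudy (proj g)
    (fundamental _ (cartanH n k)))).1 * g.1 = M := ⟨_, rfl⟩
  have hconj : ∀ γ : Cotan (proj g), ((g⁻¹).1 * (pullback g _ γ).1 * g.1).trace = 0 := fun γ => by
    rw [Matrix.trace_mul_comm, ← mul_assoc, mul_inv_val, one_mul]
    exact (pullback g _ γ).2.2.2
  have hMtr := hconj (fubiniStudy (proj g) (fundamental _ (cartanH n k)))
  have hNtr := hconj β
  have hEN := lineProj_mul_conj_pullback g β
  rw [hMdef] at hM hMtr ⊢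
  generalize (g⁻¹).1 * (pullback g _ β).1 * g.1 = N at hNtr hEN ⊢
  -- `𝔰𝔲` is isotropic, so `pr₂ N = N - pr₁ N` may be replaced by `N`.
  have h1 : imTr (pr₁ M) (pr₂ N) = imTr (pr₁ M) N := by
    have h2 := imTr_skewHermitian _ _ (pr₁_mem M hMtr).1 (pr₁_mem N hNtr).1
    simp only [imTr] at h2 ⊢
    rw [pr₂, LinearMap.sub_apply, LinearMap.id_apply, mul_sub, Matrix.trace_sub, Complex.sub_im,
      h2, sub_zero]
  have hEPN : lineProj g * firstProj n k * N = (momentum k (proj g) : ℂ) • N := by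
    conv_lhs => rw [← hEN]
    rw [← mul_assoc, lineProj_mul_firstProj_mul_lineProj, Matrix.smul_mul, hEN]
  have h3 : (pr₁ M) * N
      = (-2 * Complex.I) • ((1 - (momentum k (proj g) : ℂ)) • (firstProj n k * N)) := by
    rw [hM, pr₁_lineProj, Matrix.smul_mul, sub_mul, sub_mul, add_mul, Matrix.smul_mul,
      mul_assoc (firstProj n k) _ N, mul_assoc (firstProj n k) (lineProj g) (firstProj n k),
      mul_assoc (firstProj n k) (lineProj g * firstProj n k) N, hEPN, hEN, Matrix.mul_smul]
    module
  rw [h1, imTr, h3, imTr, cartanH_eq, sub_mul (Complex.I • _), Matrix.smul_mul, Matrix.smul_mul,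
    one_mul, Matrix.trace_sub, Matrix.trace_smul, Matrix.trace_smul, Matrix.trace_smul, Matrix.trace_smul,
    hNtr]
  simp
  ring

/-! ### The pencil and the recursion operator -/

lemma sharp_pencil_fubiniStudy {n k : ℕ} (hkn : k ≤ n) (t : ℝ) (p : CP n) :
    sharp (pencil t p) (fubiniStudy p (fundamental p (cartanH n k)))
      = (momentum k p - 1 + t) • fundamental p (cartanH n k) := by
  apply (Module.evalEquiv ℝ (Tan p)).injective
  refine LinearMap.ext fun β => ?_
  have hl : (flat p).symm (fubiniStudy p (fundamental p (cartanH n k)))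
      = fundamental p (cartanH n k) := (flat p).symm_apply_apply _
  change β (sharp (pencil t p) _) = β _
  rw [apply_sharp, pencil, LinearMap.add_apply, LinearMap.add_apply, bruhat_fubiniStudy hkn]
  simp only [piLambda, LinearMap.smul_apply, LinearMap.comp_apply, LinearEquiv.coe_coe, hl,
    Module.Dual.eval_apply, map_smul, smul_eq_mul]
  ring

lemma recursion_fundamental_cartanH {n k : ℕ} (hkn : k ≤ n) (p : CP n) :
    recursion p (fundamental p (cartanH n k))
      = (momentum k p - 1) • fundamental p (cartanH n k) := by
  apply (Module.evalEquiv ℝ (Tan p)).injective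
  refine LinearMap.ext fun β => ?_
  change β (sharp (bruhat p) (fubiniStudy p _)) = β _
  rw [apply_sharp, bruhat_fubiniStudy hkn, map_smul, smul_eq_mul]

/-- The point `[1 : 0 : … : 0 : 1]` is moved by the flow of `σ_{H_k}`. -/
lemma exists_fundamental_cartanH_ne_zero {n k : ℕ} (hk : 1 ≤ k) (hkn : k ≤ n) :
    ∃ p : CP n, fundamental p (cartanH n k) ≠ 0 := by
  have hlast : (Fin.last n) ≠ 0 := fun h => by
    have := congrArg Fin.val h
    simp at this
    omega
  obtain ⟨x, hx⟩ : ∃ x : Fin (n + 1) → ℂ, x = Pi.single 0 1 + Pi.single (Fin.last n) 1 := ⟨_, rfl⟩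
  have hx0 : x 0 = 1 := by simp [hx, hlast.symm]
  have hxn : x (Fin.last n) = 1 := by simp [hx, hlast]
  have hne : x ≠ 0 := fun h => by simp [h] at hx0
  refine ⟨Projectivization.mk ℂ x hne, fun h => ?_⟩
  have h1 := LinearMap.congr_fun h ⟨x, Submodule.mem_span_singleton_self x⟩
  change Submodule.mkQ _ (x ᵥ* cartanH n k) = 0 at h1
  rw [Submodule.mkQ_apply, Submodule.Quotient.mk_eq_zero] at h1
  obtain ⟨c, hc⟩ := Submodule.mem_span_singleton.1 h1
  have e0 := congrFun hc 0
  have en := congrFun hc (Fin.last n)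
  rw [cartanH_eq, firstProj, Matrix.vecMul_sub, Matrix.vecMul_smul, Matrix.vecMul_smul,
    Matrix.vecMul_one] at e0 en
  simp [hx0, Matrix.vecMul_diagonal, Nat.lt_of_lt_of_le Nat.zero_lt_one hk] at e0
  simp [hxn, Matrix.vecMul_diagonal, hkn.not_gt] at en
  rw [e0] at en
  have : Complex.I = 0 := by linear_combination en
  exact Complex.I_ne_zero this

end CPn

theorem mainTheorem7 (n k : ℕ) (hk : 1 ≤ k) (hkn : k ≤ n) (t : ℝ) :
    (∀ U : Set (CPn.CP n), IsOpen U → (∀ p ∈ U, CPn.momentum k p ≠ 1 - t) →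
      CPn.SmoothOn (CPn.actionVar t k) U ∧
      (∀ p ∈ U, CPn.sharp (CPn.pencil t p) (CPn.differential (CPn.actionVar t k) p) =
        CPn.fundamental p (CPn.cartanH n k)) ∧
      ∀ f : CPn.CP n → ℝ, CPn.SmoothOn f U → ∀ p ∈ U,
        CPn.bracket (CPn.pencil t) (CPn.actionVar t k) f p =
          CPn.differential f p (CPn.fundamental p (CPn.cartanH n k))) ∧
    (∃ p : CPn.CP n, CPn.fundamental p (CPn.cartanH n k) ≠ 0) ∧
    ∀ p : CPn.CP n, CPn.recursion p (CPn.fundamental p (CPn.cartanH n k)) =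
      (CPn.momentum k p - 1) • CPn.fundamental p (CPn.cartanH n k) := by
  refine ⟨fun U _ hU => ?_, CPn.exists_fundamental_cartanH_ne_zero hk hkn,
    CPn.recursion_fundamental_cartanH hkn⟩
  have hsharp : ∀ p ∈ U, CPn.sharp (CPn.pencil t p) (CPn.differential (CPn.actionVar t k) p) =
      CPn.fundamental p (CPn.cartanH n k) := by
    intro p hp
    have hne : CPn.momentum k p - 1 + t ≠ 0 := fun h => hU p hp (by linarith)
    rw [CPn.differential_actionVar t k p (hU p hp), map_smul, CPn.sharp_pencil_fubiniStudy hkn,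
      inv_smul_smul₀ hne]
  refine ⟨CPn.smoothOn_actionVar t k U hU, hsharp, fun f _ p hp => ?_⟩
  rw [CPn.bracket, ← CPn.apply_sharp, hsharp p hp]
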